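/- Consider local contextual recommendation in $\mathbb{R}^d$ over $T\ge 2$ rounds. There is a hidden point $w^*\in\mathbb{R}^d$ with $\|w^*\|_2\le 1$. In each round $t=1,\dots,T$ an adversary presents a non-empty finite set $\mathcal{X}_t\subseteq\{x\in\mathbb{R}^d:\|x\|_2\le 1\}$ of actions; the learner, possibly using randomness, outputs a list $L_t\subseteq\mathcal{X}_t$ with a designated action $x_t\in L_t$; and the learner then observes an adversarially chosen action $x_t^{\mathrm{loc}}\in\mathcal{X}_t$ with $\langle x_t^{\mathrm{loc}},w^*\rangle\ge\max_{x\in L_t}\langle x,w^*\rangle$. The adversary may be adaptive: $\mathcal{X}_t$ may depend on everything that happened in earlier rounds, and $x_t^{\mathrm{loc}}$ also on the offer $(L_t,x_t)$. The expected regret is $$\mathbb{E}\Big[\sum_{t=1}^T\Big(\max_{x\in\mathcal{X}_t}\langle x,w^*\rangle-\langle x_t,w^*\rangle\Big)\Big],$$ where the expectation is over the randomness of the learner. There is an absolute constant $C$ such that the following holds for all $d$, all $T\ge 2$, and all integers $A,H$ with $2\le H\le A$. There is a randomized algorithm for the learner (which may depend on $d,T,A,H$), with list size $|L_t|\le H$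 in every round, whose expected regret is at most $$C\cdot\frac{A}{H-1}\cdot d\log T$$ for every hidden point $w^*$ with $\|w^*\|_2\le 1$ and every adversary with $|\mathcal{X}_t|\le A$ in all rounds. -/

import Mathlib

/-!
Local contextual recommendation. There is a hidden point `w` of the unit ball of `ℝᵈ`. In each round
the learner sees a finite set `X` of actions in the unit ball, offers a list `L ⊆ X` of at most `H`
actions with one designated action (the one it recommends first, whose reward it collects), and then
observes some action of `X` which is at least as good, with respect to `w`, as every action of `L`.
-/

namespace LocalRec

/-- What a learner with list size at most `H` may put forward when the set of actions is `X`: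
a list of at most `H` actions of `X`, and a designated action `main` of this list. -/
structure Offer {d : ℕ} (X : Finset (EuclideanSpace ℝ (Fin d))) (H : ℕ) where
  list : Finset (EuclideanSpace ℝ (Fin d))
  main : EuclideanSpace ℝ (Fin d)
  main_mem : main ∈ list
  list_subset : list ⊆ X
  card_list_le : list.card ≤ H

/-- The record of one round, everything in it being visible to the learner after the round. -/
structure Round (d H : ℕ) where
  actions : Finset (EuclideanSpace ℝ (Fin d))
  nonempty : actions.Nonempty
  offer : Offer actions H
  feedback : EuclideanSpace ℝ (Fin d)

/-- A randomized learner: given the past rounds (the most recent one first) and the current set of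
actions, it chooses a distribution from which its offer is drawn, with fresh randomness. -/
abbrev Algorithm (d H : ℕ) : Type :=
  List (Round d H) → (X : Finset (EuclideanSpace ℝ (Fin d))) → X.Nonempty → PMF (Offer X H)

/-- An adversary for the hidden point `w`. It is adaptive: the action set may depend on all past
rounds (the most recent one first), and the feedback moreover on the offer of the current round. -/
structure Adversary (d A H : ℕ) (w : EuclideanSpace ℝ (Fin d)) where
  actions : List (Round d H) → Finset (EuclideanSpace ℝ (Fin d))
  nonempty : ∀ h, (actions h).Nonempty
  norm_le_one : ∀ h, ∀ x ∈ actions h, ‖x‖ ≤ 1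
  card_le : ∀ h, (actions h).card ≤ A
  feedback : (h : List (Round d H)) → Offer (actions h) H → EuclideanSpace ℝ (Fin d)
  feedback_mem : ∀ h o, feedback h o ∈ actions h
  le_feedback : ∀ h o, ∀ x ∈ o.list, inner ℝ x w ≤ inner ℝ (feedback h o) w

variable {d A H : ℕ} {w : EuclideanSpace ℝ (Fin d)}

/-- The record of the round that follows the past `h` when the learner offers `o`. -/
def nextRound (adv : Adversary d A H w) (h : List (Round d H)) (o : Offer (adv.actions h) H) :
    Round d H where
  actions := adv.actions h
  nonempty := adv.nonempty h
  offer := o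
  feedback := adv.feedback h o

/-- The law of the first `n` rounds, the most recent round first. -/
noncomputable def transcript (alg : Algorithm d H) (adv : Adversary d A H w) :
    ℕ → PMF (List (Round d H))
  | 0 => PMF.pure []
  | n + 1 => (transcript alg adv n).bind fun h =>
      (alg h (adv.actions h) (adv.nonempty h)).map fun o => nextRound adv h o :: h

/-- The regret of one round: the largest reward of an action minus the reward of the
designated action. -/
noncomputable def roundRegret (w : EuclideanSpace ℝ (Fin d)) (r : Round d H) : ℝ :=
  r.actions.sup' r.nonempty (fun x => (inner ℝ x w : ℝ)) - inner ℝ r.offer.main w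

/-- The total regret of a sequence of rounds. -/
noncomputable def regret (w : EuclideanSpace ℝ (Fin d)) (h : List (Round d H)) : ℝ :=
  (h.map (roundRegret w)).sum

/-- The expected total regret over `T` rounds. The law has finite support
(`transcript_support_finite` below), so that this is a finite sum. -/
noncomputable def expectedRegret (alg : Algorithm d H) (adv : Adversary d A H w) (T : ℕ) : ℝ :=
  ∑' h, (transcript alg adv T h).toReal * regret w h

instance (X : Finset (EuclideanSpace ℝ (Fin d))) : Finite (Offer X H) := by
  refine Finite.of_injective
    (fun o : Offer X H => ((⟨o.list, Finset.mem_powerset.2 o.list_subset⟩,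
      ⟨o.main, o.list_subset o.main_mem⟩) : X.powerset × X)) ?_
  rintro ⟨l, m, _, _, _⟩ ⟨l', m', _, _, _⟩ e
  simp only [Prod.mk.injEq, Subtype.mk.injEq] at e
  obtain ⟨rfl, rfl⟩ := e
  rfl

theorem transcript_support_finite (alg : Algorithm d H) (adv : Adversary d A H w) (T : ℕ) :
    (transcript alg adv T).support.Finite := by
  induction T with
  | zero => simp [transcript]
  | succ n ih =>
    rw [transcript, PMF.support_bind]
    refine ih.biUnion fun h _ => ?_
    rw [PMF.support_map]
    exact (Set.toFinite _).image _

end LocalRec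

open Matrix

namespace LocalRec

/-! ### Log-determinant potential for the second-order perceptron -/

section Potential

variable {n : Type*} [Fintype n]

/-! The learner runs a second-order perceptron on the improvements `y = feedback - main`. With `G =
1 + ∑ y yᵀ` and `s = ∑ y`, its main action is greedy for the prediction `G⁻¹ s`. The feedback is
itself an available action, so each new `y` has nonpositive product with the current prediction.
Hence `s ⬝ G⁻¹ s` never exceeds `log det G` (`quadratic_sum_le_log_det`). By Cauchy–Schwarz, `(s ⬝
w)² ≤ log det G * (w ⬝ G w)`, and `0 ≤ y ⬝ w ≤ 2` bounds the last factor by `1 + 2 (s ⬝ w)`. This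
self-bounding inequality makes the total improvement `s ⬝ w` of order `d log T` on every sample path
(`sum_dotProduct_le`).

Improvement pays for regret. Random companions put the best action on the list with probability at
least `(H - 1) / A`, and the improvement is then at least the regret of the round. In conditional
expectation, `(H - 1) / A` times the regret is thus at most the improvement (`mean_excess_nonpos`).
-/

theorem dotProduct_mulVec_symm {A : Matrix n n ℝ} (hA : A.PosDef) (x y : n → ℝ) :
    x ⬝ᵥ A *ᵥ y = y ⬝ᵥ A *ᵥ x := by
  have h : Aᵀ = A := by simpa using hA.isHermitian.eq
  rw [dotProduct_mulVec, ← mulVec_transpose, h, dotProduct_comm]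

theorem dotProduct_mulVec_self_nonneg {A : Matrix n n ℝ} (hA : A.PosDef) (x : n → ℝ) :
    0 ≤ x ⬝ᵥ A *ᵥ x := by
  simpa using hA.posSemidef.dotProduct_mulVec_nonneg x

theorem dotProduct_list_sum (l : List (n → ℝ)) (u : n → ℝ) :
    l.sum ⬝ᵥ u = (l.map fun y => y ⬝ᵥ u).sum := by
  induction l with
  | nil => simp
  | cons y l ih => simp [add_dotProduct, ih]

variable [DecidableEq n]

/-- The regularized Gram matrix `1 + ∑ y yᵀ` of a list of vectors. -/
noncomputable def gram : List (n → ℝ) → Matrix n n ℝ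
  | [] => 1
  | y :: l => gram l + vecMulVec y y

theorem dotProduct_gram_mulVec (l : List (n → ℝ)) (x z : n → ℝ) :
    x ⬝ᵥ gram l *ᵥ z = x ⬝ᵥ z + (l.map fun y => (x ⬝ᵥ y) * (y ⬝ᵥ z)).sum := by
  induction l with
  | nil => simp [gram]
  | cons y l ih =>
    simp only [gram, add_mulVec, dotProduct_add, ih, vecMulVec_mulVec, List.map_cons,
      List.sum_cons]
    simp [dotProduct_smul, mul_comm]
    ring

theorem posDef_gram (l : List (n → ℝ)) : (gram l).PosDef := by
  induction l with
  | nil => exact Matrix.PosDef.one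
  | cons y l ih =>
    have := posSemidef_vecMulVec_self_star y
    rw [star_trivial] at this
    exact ih.add_posSemidef this

theorem mulVec_inv_mulVec {A : Matrix n n ℝ} (hA : A.PosDef) (v : n → ℝ) :
    A *ᵥ (A⁻¹ *ᵥ v) = v := by
  rw [mulVec_mulVec, mul_nonsing_inv _ hA.det_pos.ne'.isUnit, one_mulVec]

theorem inv_mulVec_eq {A : Matrix n n ℝ} (hA : A.PosDef) {u v : n → ℝ} (h : A *ᵥ u = v) :
    A⁻¹ *ᵥ v = u := by
  rw [← h, mulVec_mulVec, nonsing_inv_mul _ hA.det_pos.ne'.isUnit, one_mulVec]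

/-- The Cauchy–Schwarz inequality for a positive definite matrix and its inverse. -/
theorem sq_dotProduct_le {A : Matrix n n ℝ} (hA : A.PosDef) (u v : n → ℝ) :
    (v ⬝ᵥ u) ^ 2 ≤ (v ⬝ᵥ A⁻¹ *ᵥ v) * (u ⬝ᵥ A *ᵥ u) := by
  -- The `A`-form of `u - t A⁻¹ v` is a nonnegative quadratic in `t`, so its discriminant is
  -- nonpositive.
  have key : ∀ t : ℝ, 0 ≤ (v ⬝ᵥ A⁻¹ *ᵥ v) * (t * t) + (-2 * (v ⬝ᵥ u)) * t + u ⬝ᵥ A *ᵥ u := by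
    intro t
    have h := dotProduct_mulVec_self_nonneg hA (u - t • (A⁻¹ *ᵥ v))
    simp only [mulVec_sub, mulVec_smul, mulVec_inv_mulVec hA, sub_dotProduct, dotProduct_sub,
      smul_dotProduct, dotProduct_smul, smul_eq_mul,
      dotProduct_mulVec_symm hA (A⁻¹ *ᵥ v) u] at h
    rw [dotProduct_comm u v, dotProduct_comm _ v] at h
    linarith
  have h := discrim_le_zero key
  rw [discrim] at h
  linarith

theorem det_add_vecMulVec {A : Matrix n n ℝ} (hA : A.PosDef) (y : n → ℝ) :
    (A + vecMulVec y y).det = A.det * (1 + y ⬝ᵥ A⁻¹ *ᵥ y) := by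
  rw [vecMulVec_eq Unit, det_add_replicateCol_mul_replicateRow hA.det_pos.ne'.isUnit,
    det_unique (n := Unit), Matrix.add_apply, one_apply_eq, Matrix.mul_assoc,
    ← replicateCol_mulVec, replicateRow_mul_replicateCol_apply]

/-- One step of the potential argument: adding a vector which does not point in the direction of
the current prediction. -/
theorem quadratic_add_vecMulVec_le {A : Matrix n n ℝ} (hA : A.PosDef) (v y : n → ℝ)
    (hA' : (A + vecMulVec y y).PosDef) (hy : y ⬝ᵥ A⁻¹ *ᵥ v ≤ 0) :
    (y + v) ⬝ᵥ (A + vecMulVec y y)⁻¹ *ᵥ (y + v) ≤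
      v ⬝ᵥ A⁻¹ *ᵥ v + Real.log (1 + y ⬝ᵥ A⁻¹ *ᵥ y) := by
  set s := y ⬝ᵥ A⁻¹ *ᵥ y with hs
  set a := y ⬝ᵥ A⁻¹ *ᵥ v with ha
  have hs0 : 0 ≤ s := dotProduct_mulVec_self_nonneg hA.inv y
  have hsym : v ⬝ᵥ A⁻¹ *ᵥ y = a := dotProduct_mulVec_symm hA.inv v y
  -- Sherman–Morrison, checked by multiplying back.
  have hinv : (A + vecMulVec y y)⁻¹ *ᵥ (y + v) =
      A⁻¹ *ᵥ v + ((1 - a) / (1 + s)) • (A⁻¹ *ᵥ y) := by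
    apply inv_mulVec_eq hA'
    rw [add_mulVec, vecMulVec_mulVec, mulVec_add, mulVec_smul, mulVec_inv_mulVec hA,
      mulVec_inv_mulVec hA, dotProduct_add, dotProduct_smul, ← hs, ← ha]
    ext i
    simp only [Pi.add_apply, Pi.smul_apply, smul_eq_mul, MulOpposite.smul_eq_mul_unop,
      MulOpposite.unop_op]
    field_simp
    ring
  rw [hinv, dotProduct_add, dotProduct_smul, add_dotProduct, add_dotProduct, hsym, ← hs, ← ha,
    smul_eq_mul]
  have hlog : s / (1 + s) ≤ Real.log (1 + s) := by
    refine le_trans (le_of_eq ?_) (Real.one_sub_inv_le_log_of_pos (by linarith))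
    field_simp
    ring
  have : a + (1 - a) / (1 + s) * (s + a) ≤ s / (1 + s) := by
    rw [div_mul_eq_mul_div, ← sub_nonneg]
    -- The sign hypothesis `a ≤ 0` enters here: it makes `a ^ 2 - 2 * a` nonnegative.
    have : s / (1 + s) - (a + (1 - a) * (s + a) / (1 + s)) = (a ^ 2 - 2 * a) / (1 + s) := by
      field_simp
      ring
    rw [this]
    apply div_nonneg <;> nlinarith
  linarith

/-- Every vector of the list (the latest one first) points away from the prediction
`(gram l)⁻¹ *ᵥ l.sum` made from the earlier ones. -/
def Opposing : List (n → ℝ) → Prop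
  | [] => True
  | y :: l => y ⬝ᵥ (gram l)⁻¹ *ᵥ l.sum ≤ 0 ∧ Opposing l

/-- Telescoping: the allowance `log (1 + y ⬝ A⁻¹ y)` of one step is exactly the increment of `log
det`, by the matrix determinant lemma. -/
theorem quadratic_sum_le_log_det {l : List (n → ℝ)} (hl : Opposing l) :
    l.sum ⬝ᵥ (gram l)⁻¹ *ᵥ l.sum ≤ Real.log (gram l).det := by
  induction l with
  | nil => simp [gram]
  | cons y l ih =>
    have h := quadratic_add_vecMulVec_le (posDef_gram l) l.sum y (posDef_gram (y :: l)) hl.1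
    have hs := dotProduct_mulVec_self_nonneg (posDef_gram l).inv y
    rw [List.sum_cons]
    refine h.trans ?_
    rw [gram, det_add_vecMulVec (posDef_gram l),
      Real.log_mul (posDef_gram l).det_pos.ne' (by linarith)]
    linarith [ih hl.2]

theorem trace_gram_le {l : List (n → ℝ)} {b : ℝ} (hl : ∀ y ∈ l, y ⬝ᵥ y ≤ b) :
    (gram l).trace ≤ Fintype.card n + b * l.length := by
  induction l with
  | nil => simp [gram]
  | cons y l ih =>
    rw [gram, trace_add, trace_vecMulVec, List.length_cons]
    push_cast
    have := hl y List.mem_cons_self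
    linarith [ih fun z hz => hl z (List.mem_cons_of_mem _ hz)]

/-- Concavity of `log`: each eigenvalue is compared with the tangent line at `c`, and the linear
terms add up to the trace. -/
theorem log_det_le {A : Matrix n n ℝ} (hA : A.PosDef) {c : ℝ} (hc : 0 < c)
    (h : A.trace ≤ Fintype.card n * c) : Real.log A.det ≤ Fintype.card n * Real.log c := by
  rw [hA.isHermitian.det_eq_prod_eigenvalues]
  rw [hA.isHermitian.trace_eq_sum_eigenvalues] at h
  simp only [RCLike.ofReal_real_eq_id, id] at h ⊢
  rw [Real.log_prod fun i _ => (hA.eigenvalues_pos i).ne']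
  have : ∀ i, Real.log (hA.isHermitian.eigenvalues i) ≤
      Real.log c + (hA.isHermitian.eigenvalues i / c - 1) := fun i => by
    have := Real.log_le_sub_one_of_pos (div_pos (hA.eigenvalues_pos i) hc)
    rw [Real.log_div (hA.eigenvalues_pos i).ne' hc.ne'] at this
    linarith
  refine (Finset.sum_le_sum fun i _ => this i).trans ?_
  rw [Finset.sum_add_distrib, Finset.sum_sub_distrib, ← Finset.sum_div]
  have := (div_le_iff₀ hc).2 h
  simp only [Finset.sum_const, Finset.card_univ, nsmul_eq_mul, mul_one]
  linarith

theorem log_det_gram_le {l : List (n → ℝ)} {b : ℝ} (hb : 0 ≤ b) (hl : ∀ y ∈ l, y ⬝ᵥ y ≤ b) :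
    Real.log (gram l).det ≤ Fintype.card n * Real.log (1 + b * l.length) := by
  have hbl : 0 ≤ b * l.length := by positivity
  rcases isEmpty_or_nonempty n with h | h
  · simp
  · refine log_det_le (posDef_gram l) (by positivity) ((trace_gram_le hl).trans ?_)
    have : (1 : ℝ) ≤ Fintype.card n := by exact_mod_cast Fintype.card_pos
    nlinarith

/-- A quadratic inequality for the total gain `l.sum ⬝ᵥ u`. -/
theorem sq_sum_dotProduct_le {l : List (n → ℝ)} (hl : Opposing l) {u : n → ℝ} (hu : u ⬝ᵥ u ≤ 1)
    (h0 : ∀ y ∈ l, 0 ≤ y ⬝ᵥ u) (h2 : ∀ y ∈ l, y ⬝ᵥ u ≤ 2) :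
    (l.sum ⬝ᵥ u) ^ 2 ≤ Real.log (gram l).det * (1 + 2 * (l.sum ⬝ᵥ u)) := by
  have hq : u ⬝ᵥ gram l *ᵥ u ≤ 1 + 2 * (l.sum ⬝ᵥ u) := by
    rw [dotProduct_gram_mulVec, dotProduct_list_sum, ← List.sum_map_mul_left]
    refine add_le_add hu (List.sum_le_sum fun y hy => ?_)
    rw [dotProduct_comm u y]
    exact mul_le_mul_of_nonneg_right (h2 y hy) (h0 y hy)
  have hu0 := dotProduct_mulVec_self_nonneg (posDef_gram l) u
  calc _ ≤ _ := sq_dotProduct_le (posDef_gram l) u l.sum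
    _ ≤ _ := mul_le_mul_of_nonneg_right (quadratic_sum_le_log_det hl) hu0
    _ ≤ _ := mul_le_mul_of_nonneg_left hq
      ((dotProduct_mulVec_self_nonneg (posDef_gram l).inv l.sum).trans
        (quadratic_sum_le_log_det hl))

theorem log_one_add_four_mul_le {T : ℕ} (hT : 2 ≤ T) :
    Real.log (1 + 4 * T) ≤ 4 * Real.log T := by
  have hT' : (2 : ℝ) ≤ T := by exact_mod_cast hT
  rw [show (4 : ℝ) * Real.log T = Real.log ((T : ℝ) ^ 4) by simp]
  apply Real.log_le_log (by positivity)
  have : (8 : ℝ) ≤ (T : ℝ) ^ 3 := by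
    calc (8 : ℝ) = 2 ^ 3 := by norm_num
      _ ≤ _ := by gcongr
  nlinarith

theorem sum_dotProduct_le {l : List (n → ℝ)} (hl : Opposing l) {u : n → ℝ} (hu : u ⬝ᵥ u ≤ 1)
    (h0 : ∀ y ∈ l, 0 ≤ y ⬝ᵥ u) (h2 : ∀ y ∈ l, y ⬝ᵥ u ≤ 2) (h4 : ∀ y ∈ l, y ⬝ᵥ y ≤ 4)
    (hT : 2 ≤ l.length) :
    l.sum ⬝ᵥ u ≤ 14 * (Fintype.card n * Real.log l.length) := by
  rcases isEmpty_or_nonempty n with h | h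
  · simp
  have hD := log_det_gram_le (by norm_num) h4
  have hlog := log_one_add_four_mul_le hT
  have hsq := sq_sum_dotProduct_le hl hu h0 h2
  have hcard : (1 : ℝ) ≤ Fintype.card n := by exact_mod_cast Fintype.card_pos
  have hlog2 : (1 : ℝ) / 2 ≤ Real.log l.length :=
    (by linarith [Real.log_two_gt_d9] : (1 : ℝ) / 2 ≤ Real.log 2).trans
      (Real.log_le_log (by norm_num) (by exact_mod_cast hT))
  have hm := mul_le_mul_of_nonneg_left hlog (zero_le_one.trans hcard)
  have hR : (1 : ℝ) / 2 ≤ Fintype.card n * Real.log l.length := by nlinarith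
  -- The inequality is now `S² ≤ 4R(1 + 2S)`. If `S > 14R`, then `8RS < (4/7)S²`, and `R ≥ 1/2`
  -- gives `S > 7`, so `4R < (2/7)S < (2/49)S²`: a contradiction.
  by_contra! hS
  set S := l.sum ⬝ᵥ u
  set R := (Fintype.card n : ℝ) * Real.log l.length
  have hDR : Real.log (gram l).det ≤ 4 * R := by linarith
  nlinarith [mul_le_mul_of_nonneg_right hDR (by linarith : 0 ≤ 1 + 2 * S)]

end Potential

/-! ### Expectations under finitely supported laws -/

section Mean

variable {α β : Type*}

/-- The expectation of a real function (meaningful for laws of finite support). -/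
noncomputable def mean (p : PMF α) (f : α → ℝ) : ℝ := ∑' a, (p a).toReal * f a

theorem mean_eq_sum (p : PMF α) {s : Finset α} (hs : p.support ⊆ s) (f : α → ℝ) :
    mean p f = ∑ a ∈ s, (p a).toReal * f a := by
  refine tsum_eq_sum fun a ha => ?_
  rw [(p.apply_eq_zero_iff a).2 fun h => ha (hs h)]
  simp

theorem sum_toReal_eq_one (p : PMF α) {s : Finset α} (hs : p.support ⊆ s) :
    ∑ a ∈ s, (p a).toReal = 1 := by
  rw [← ENNReal.toReal_sum fun a _ => p.apply_ne_top a, ← tsum_eq_sum (L := .unconditional α)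
    fun a ha => (p.apply_eq_zero_iff a).2 fun h => ha (hs h), p.tsum_coe, ENNReal.toReal_one]

theorem mean_pure (a : α) (f : α → ℝ) : mean (PMF.pure a) f = f a := by
  rw [mean_eq_sum (s := {a}) _ (by simp)]
  simp

theorem mean_le_mean_add_const {p : PMF α} (hp : p.support.Finite) {f g : α → ℝ} {b : ℝ}
    (h : ∀ a ∈ p.support, f a ≤ g a + b) : mean p f ≤ mean p g + b := by
  have hs : p.support ⊆ hp.toFinset := by simp
  rw [mean_eq_sum p hs, mean_eq_sum p hs]
  calc _ ≤ ∑ a ∈ hp.toFinset, ((p a).toReal * g a + (p a).toReal * b) :=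
        Finset.sum_le_sum fun a ha => by
          rw [← mul_add]
          exact mul_le_mul_of_nonneg_left (h a (by simpa using ha)) ENNReal.toReal_nonneg
    _ = _ := by
      rw [Finset.sum_add_distrib, ← Finset.sum_mul, sum_toReal_eq_one p hs, one_mul]

theorem mean_const_mul (p : PMF α) (c : ℝ) (f : α → ℝ) :
    mean p (fun a => c * f a) = c * mean p f := by
  simp only [mean, ← tsum_mul_left]
  exact tsum_congr fun a => by ring

theorem mean_bind {p : PMF α} {q : α → PMF β} (hp : p.support.Finite)
    (hq : ∀ a, (q a).support.Finite) (f : β → ℝ) :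
    mean (p.bind q) f = mean p fun a => mean (q a) f := by
  have hs : p.support ⊆ hp.toFinset := by simp
  have ht : (p.bind q).support.Finite := by
    rw [PMF.support_bind]
    exact hp.biUnion fun a _ => hq a
  have hbind : ∀ b, (p.bind q b).toReal = ∑ a ∈ hp.toFinset, (p a).toReal * (q a b).toReal := by
    intro b
    rw [PMF.bind_apply, tsum_eq_sum (s := hp.toFinset), ENNReal.toReal_sum]
    · simp
    · exact fun a _ => ENNReal.mul_ne_top (p.apply_ne_top a) ((q a).apply_ne_top b)
    · intro a ha
      rw [(p.apply_eq_zero_iff a).2 fun h => ha (hs h), zero_mul]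
  rw [mean_eq_sum _ (s := ht.toFinset) (by simp), mean_eq_sum p hs]
  simp only [hbind, Finset.sum_mul]
  rw [Finset.sum_comm]
  refine Finset.sum_congr rfl fun a ha => ?_
  rw [mean_eq_sum (q a) (s := ht.toFinset), Finset.mul_sum]
  · simp only [mul_assoc]
  · intro b hb
    rw [Set.Finite.coe_toFinset, PMF.support_bind]
    exact Set.mem_biUnion (by simpa using ha) hb

theorem mean_map {p : PMF α} (hp : p.support.Finite) (g : α → β) (f : β → ℝ) :
    mean (p.map g) f = mean p fun a => f (g a) := by
  rw [← PMF.bind_pure_comp, mean_bind hp fun a => by simp]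
  simp only [Function.comp, mean_pure]

theorem mean_uniformOfFintype [Fintype α] [Nonempty α] (f : α → ℝ) :
    mean (PMF.uniformOfFintype α) f = (∑ a, f a) / Fintype.card α := by
  rw [mean_eq_sum _ (s := Finset.univ) (by simp), div_eq_inv_mul, Finset.mul_sum]
  simp

end Mean

/-! ### Inclusion probability of a random subset -/

section Sampling

variable {α : Type*} [DecidableEq α]

/-- A uniformly random subset of size `k` contains a given element with probability `k / n`. -/
theorem card_mul_card_filter_mem_powersetCard {s : Finset α} {x : α} (hx : x ∈ s) {k : ℕ}
    (hk : k ≤ s.card) :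
    (s.card : ℝ) * ((s.powersetCard k).filter (x ∈ ·)).card = k * (s.powersetCard k).card := by
  -- The complement is easier to count: subsets avoiding `x` are the `k`-subsets of `s.erase x`.
  have hnot : (s.powersetCard k).filter (x ∉ ·) = (s.erase x).powersetCard k := by
    ext t
    simp only [Finset.mem_filter, Finset.mem_powersetCard, Finset.subset_erase]
    tauto
  have hsum := Finset.card_filter_add_card_filter_not (s := s.powersetCard k) (x ∈ ·)
  obtain ⟨n, hn⟩ : ∃ n, s.card = n + 1 := ⟨s.card - 1, by
    have := Finset.card_pos.2 ⟨x, hx⟩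
    omega⟩
  rw [hnot, Finset.card_powersetCard, Finset.card_erase_of_mem hx, hn, Nat.add_sub_cancel,
    Finset.card_powersetCard, hn] at hsum
  have hch := Nat.choose_mul_succ_eq n k
  rw [hn] at hk
  rw [Finset.card_powersetCard, hn]
  zify [hk] at hch hsum
  have hch' : (n.choose k : ℝ) * (n + 1) = (n + 1).choose k * (n + 1 - k) := by exact_mod_cast hch
  have hsum' : (((s.powersetCard k).filter (x ∈ ·)).card : ℝ) + n.choose k = (n + 1).choose k := by
    exact_mod_cast hsum
  push_cast
  linear_combination (n + 1 : ℝ) * hsum' - hch'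

end Sampling

/-! ### The learner and its regret -/

section Learner

variable {d A H : ℕ} {w : EuclideanSpace ℝ (Fin d)}

/-- By how much the feedback of a round improves on the designated action. -/
def improvement (r : Round d H) : Fin d → ℝ := (r.feedback - r.offer.main).ofLp

/-- The second-order perceptron prediction of the hidden point. -/
noncomputable def prediction (h : List (Round d H)) : EuclideanSpace ℝ (Fin d) :=
  WithLp.toLp 2 ((gram (h.map improvement))⁻¹ *ᵥ (h.map improvement).sum)

/-- An action which is best according to the prediction. -/
noncomputable def greedy (h : List (Round d H)) (X : Finset (EuclideanSpace ℝ (Fin d)))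
    (hX : X.Nonempty) : EuclideanSpace ℝ (Fin d) :=
  (X.exists_max_image (fun x => (inner ℝ x (prediction h) : ℝ)) hX).choose

theorem greedy_mem (h : List (Round d H)) (X : Finset (EuclideanSpace ℝ (Fin d)))
    (hX : X.Nonempty) : greedy h X hX ∈ X :=
  (X.exists_max_image (fun x => (inner ℝ x (prediction h) : ℝ)) hX).choose_spec.1

theorem inner_le_greedy (h : List (Round d H)) (X : Finset (EuclideanSpace ℝ (Fin d)))
    (hX : X.Nonempty) {x : EuclideanSpace ℝ (Fin d)} (hx : x ∈ X) :
    (inner ℝ x (prediction h) : ℝ) ≤ inner ℝ (greedy h X hX) (prediction h) :=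
  (X.exists_max_image (fun x => (inner ℝ x (prediction h) : ℝ)) hX).choose_spec.2 x hx

open Classical in
/-- The sets of companions that may be offered along with the action `m`. -/
noncomputable def companions (H : ℕ) (X : Finset (EuclideanSpace ℝ (Fin d)))
    (m : EuclideanSpace ℝ (Fin d)) : Finset (Finset (EuclideanSpace ℝ (Fin d))) :=
  -- The minimum keeps the family nonempty when fewer than `H - 1` other actions exist.
  (X.erase m).powersetCard (min (H - 1) (X.erase m).card)

instance (X : Finset (EuclideanSpace ℝ (Fin d))) (m : EuclideanSpace ℝ (Fin d)) :
    Nonempty (companions H X m) :=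
  (Finset.powersetCard_nonempty.2 (min_le_right _ _)).to_subtype

open Classical in
/-- The offer of the action `m` together with a set of companions. -/
noncomputable def offerWith (hH : 2 ≤ H) {X : Finset (EuclideanSpace ℝ (Fin d))}
    {m : EuclideanSpace ℝ (Fin d)} (hm : m ∈ X) (S : companions H X m) : Offer X H where
  list := insert m S.1
  main := m
  main_mem := Finset.mem_insert_self _ _
  list_subset := Finset.insert_subset hm
    ((Finset.mem_powersetCard.1 S.2).1.trans (Finset.erase_subset _ _))
  card_list_le := by
    have h1 := Finset.card_insert_le m S.1
    have h2 := (Finset.mem_powersetCard.1 S.2).2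
    have h3 := min_le_left (H - 1) (X.erase m).card
    omega

/-- The learner: it recommends the action which is best according to the prediction, along with
uniformly random other actions. -/
noncomputable def perceptron (d : ℕ) (hH : 2 ≤ H) : Algorithm d H := fun h X hX =>
  (PMF.uniformOfFintype (companions H X (greedy h X hX))).map (offerWith hH (greedy_mem h X hX))

theorem main_eq_greedy {hH : 2 ≤ H} {h : List (Round d H)}
    {X : Finset (EuclideanSpace ℝ (Fin d))} {hX : X.Nonempty} {o : Offer X H}
    (ho : o ∈ (perceptron d hH h X hX).support) : o.main = greedy h X hX := by
  rw [perceptron, PMF.support_map] at ho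
  obtain ⟨S, -, rfl⟩ := ho
  rfl

open Classical in
/-- Every action is offered with probability at least `(H - 1) / A`. -/
theorem le_card_filter_companions (hH : 2 ≤ H) (hHA : H ≤ A)
    {X : Finset (EuclideanSpace ℝ (Fin d))} (hXA : X.card ≤ A) {m x : EuclideanSpace ℝ (Fin d)}
    (hm : m ∈ X) (hx : x ∈ X) :
    ((H : ℝ) - 1) / A * (companions H X m).card ≤
      ((companions H X m).filter fun S => x ∈ insert m S).card := by
  have hH' : (2 : ℝ) ≤ H := by exact_mod_cast hH
  have hHA' : (H : ℝ) ≤ A := by exact_mod_cast hHA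
  have hA0 : (0 : ℝ) < A := by linarith
  have hle1 : ((H : ℝ) - 1) / A ≤ 1 := by
    rw [div_le_one hA0]
    linarith
  have hcard0 : (0 : ℝ) ≤ (companions H X m).card := Nat.cast_nonneg _
  by_cases hxm : x = m
  · rw [Finset.filter_true_of_mem fun S _ => by simp [hxm]]
    nlinarith
  have hx' : x ∈ X.erase m := Finset.mem_erase.2 ⟨hxm, hx⟩
  have hcount := card_mul_card_filter_mem_powersetCard hx' (min_le_right (H - 1) _)
  simp only [Finset.mem_insert, hxm, false_or]
  rw [companions] at hcard0 ⊢
  set n := (X.erase m).card with hn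
  have hn0 : 0 < n := Finset.card_pos.2 ⟨x, hx'⟩
  have hnA : n < A := by
    have := Finset.card_erase_lt_of_mem hm
    omega
  have hn0' : (0 : ℝ) < n := by exact_mod_cast hn0
  have hnA' : (n : ℝ) ≤ A := by exact_mod_cast hnA.le
  -- With `k = min (H - 1) n` companions among `n`, the inclusion probability `k / n` is either `(H
  -- - 1) / n`, where `n < A`, or `1`.
  have hk : ((H : ℝ) - 1) / A * n ≤ (min (H - 1) n : ℕ) := by
    rw [Nat.cast_min, Nat.cast_sub (by omega), Nat.cast_one]
    refine le_min ?_ (by nlinarith)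
    rw [div_mul_eq_mul_div, div_le_iff₀ hA0]
    nlinarith
  refine le_of_mul_le_mul_left ?_ hn0'
  rw [hcount]
  nlinarith

theorem inner_main_le_feedback (adv : Adversary d A H w) (h : List (Round d H))
    (o : Offer (adv.actions h) H) :
    0 ≤ (inner ℝ (adv.feedback h o - o.main) w : ℝ) := by
  rw [inner_sub_left]
  exact sub_nonneg.2 (adv.le_feedback h o _ o.main_mem)

/-- The excess of the scaled regret of a round over the observed improvement. -/
noncomputable def excess (A : ℕ) (w : EuclideanSpace ℝ (Fin d)) (r : Round d H) : ℝ :=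
  ((H : ℝ) - 1) / A * roundRegret w r - inner ℝ (r.feedback - r.offer.main) w

theorem sum_excess (A : ℕ) (w : EuclideanSpace ℝ (Fin d)) (h : List (Round d H)) :
    (h.map (excess A w)).sum = ((H : ℝ) - 1) / A * regret w h -
      (h.map fun r => (inner ℝ (r.feedback - r.offer.main) w : ℝ)).sum := by
  induction h with
  | nil => simp [regret]
  | cons r h ih =>
    simp only [regret, List.map_cons, List.sum_cons] at ih ⊢
    rw [ih, excess]
    ring

/-- Given the past, the main action is fixed, hence so is the regret `R`. The improvement is at
least `R` when the best action `x` is listed, and nonnegative otherwise. -/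
theorem mean_excess_nonpos (hH : 2 ≤ H) (hHA : H ≤ A) (adv : Adversary d A H w)
    (h : List (Round d H)) :
    mean (perceptron d hH h (adv.actions h) (adv.nonempty h))
      (fun o => excess A w (nextRound adv h o)) ≤ 0 := by
  classical
  set X := adv.actions h
  set hX : X.Nonempty := adv.nonempty h
  set m := greedy h X hX with hm
  have hmX : m ∈ X := greedy_mem h X hX
  obtain ⟨x, hx, hsup⟩ := X.exists_mem_eq_sup' hX fun x => (inner ℝ x w : ℝ)
  set R : ℝ := inner ℝ x w - inner ℝ m w
  have hR : 0 ≤ R := by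
    have := X.le_sup' (fun x => (inner ℝ x w : ℝ)) hmX
    rw [hsup] at this
    exact sub_nonneg.2 this
  rw [perceptron, mean_map (Set.toFinite _), mean_uniformOfFintype]
  refine div_nonpos_of_nonpos_of_nonneg ?_ (Nat.cast_nonneg _)
  have hle : ∀ S : companions H X m, excess A w (nextRound adv h (offerWith hH hmX S)) ≤
      ((H : ℝ) - 1) / A * R - if x ∈ insert m S.1 then R else 0 := by
    intro S
    have hreg : roundRegret w (nextRound adv h (offerWith hH hmX S)) = R := by
      unfold roundRegret
      exact congrArg (· - (inner ℝ m w : ℝ)) hsup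
    rw [excess, hreg]
    refine sub_le_sub_left ?_ _
    split_ifs with hxS
    · have := adv.le_feedback h (offerWith hH hmX S) x hxS
      change R ≤ inner ℝ (adv.feedback h (offerWith hH hmX S) - m) w
      rw [inner_sub_left]
      linarith
    · exact inner_main_le_feedback adv h (offerWith hH hmX S)
  refine (Finset.sum_le_sum fun S _ => hle S).trans ?_
  rw [Finset.sum_coe_sort (companions H X m)
    fun S => ((H : ℝ) - 1) / A * R - if x ∈ insert m S then R else 0, Finset.sum_sub_distrib,
    ← Finset.sum_filter, Finset.sum_const, Finset.sum_const, nsmul_eq_mul, nsmul_eq_mul]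
  have := le_card_filter_companions hH hHA (adv.card_le h) hmX hx
  have := mul_le_mul_of_nonneg_right this hR
  linarith

theorem mean_transcript_succ (alg : Algorithm d H) (adv : Adversary d A H w) (n : ℕ)
    (f : List (Round d H) → ℝ) :
    mean (transcript alg adv (n + 1)) f = mean (transcript alg adv n) fun h =>
      mean (alg h (adv.actions h) (adv.nonempty h)) fun o => f (nextRound adv h o :: h) := by
  rw [transcript, mean_bind (transcript_support_finite alg adv n)]
  · simp only [mean_map (Set.toFinite _)]
  · intro h
    rw [PMF.support_map]
    exact (Set.toFinite _).image _

/-- Summing a function of the rounds which has nonpositive conditional expectations. -/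
theorem mean_sum_nonpos (alg : Algorithm d H) (adv : Adversary d A H w) {φ : Round d H → ℝ}
    (hφ : ∀ h, mean (alg h (adv.actions h) (adv.nonempty h))
      (fun o => φ (nextRound adv h o)) ≤ 0) (n : ℕ) :
    mean (transcript alg adv n) (fun h => (h.map φ).sum) ≤ 0 := by
  induction n with
  | zero => simp [transcript, mean_pure]
  | succ n ih =>
    rw [mean_transcript_succ]
    refine le_trans ?_ ih
    refine (mean_le_mean_add_const (b := 0) (transcript_support_finite alg adv n)
      fun h _ => ?_).trans_eq (add_zero _)
    rw [add_zero]
    refine (mean_le_mean_add_const (g := fun o => φ (nextRound adv h o)) (b := (h.map φ).sum)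
      (Set.toFinite _) fun o _ => by simp).trans ?_
    linarith [hφ h]

/-! ### Pathwise bound on the improvement -/

theorem inner_eq_dotProduct (x y : EuclideanSpace ℝ (Fin d)) :
    (inner ℝ x y : ℝ) = x.ofLp ⬝ᵥ y.ofLp := by
  rw [EuclideanSpace.inner_eq_star_dotProduct, star_trivial, dotProduct_comm]

theorem length_of_mem_support (alg : Algorithm d H) (adv : Adversary d A H w) (n : ℕ)
    {h : List (Round d H)} (hh : h ∈ (transcript alg adv n).support) : h.length = n := by
  induction n generalizing h with
  | zero => simp_all [transcript]
  | succ n ih =>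
    simp only [transcript, PMF.mem_support_bind_iff, PMF.mem_support_map_iff] at hh
    obtain ⟨h', hh', o, -, rfl⟩ := hh
    simp [ih hh']

/-- Greediness: the feedback cannot beat the main action under the prediction, whatever the
companions. -/
theorem opposing_of_mem_support (hH : 2 ≤ H) (adv : Adversary d A H w) (n : ℕ)
    {h : List (Round d H)} (hh : h ∈ (transcript (perceptron d hH) adv n).support) :
    Opposing (h.map improvement) := by
  induction n generalizing h with
  | zero => simp_all [transcript, Opposing]
  | succ n ih =>
    simp only [transcript, PMF.mem_support_bind_iff, PMF.mem_support_map_iff] at hh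
    obtain ⟨h', hh', o, ho, rfl⟩ := hh
    refine ⟨?_, ih hh'⟩
    have hg := inner_le_greedy h' _ (adv.nonempty h') (adv.feedback_mem h' o)
    rw [← main_eq_greedy ho, ← sub_nonpos, ← inner_sub_left, inner_eq_dotProduct] at hg
    exact hg

theorem mem_of_mem_support (alg : Algorithm d H) (adv : Adversary d A H w) (n : ℕ)
    {h : List (Round d H)} (hh : h ∈ (transcript alg adv n).support) {r : Round d H}
    (hr : r ∈ h) : ∃ (h' : List (Round d H)) (o : _), r = nextRound adv h' o := by
  induction n generalizing h with
  | zero => simp_all [transcript]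
  | succ n ih =>
    simp only [transcript, PMF.mem_support_bind_iff, PMF.mem_support_map_iff] at hh
    obtain ⟨h', hh', o, -, rfl⟩ := hh
    rcases List.mem_cons.1 hr with rfl | hr
    · exact ⟨h', o, rfl⟩
    · exact ih hh' hr

theorem norm_feedback_sub_main_le (adv : Adversary d A H w) (h : List (Round d H))
    (o : Offer (adv.actions h) H) : ‖adv.feedback h o - o.main‖ ≤ 2 := by
  have h1 := adv.norm_le_one h _ (adv.feedback_mem h o)
  have h2 := adv.norm_le_one h _ (o.list_subset o.main_mem)
  linarith [norm_sub_le (adv.feedback h o) o.main]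

/-- The total observed improvement is logarithmic, whatever the adversary and the random choices. -/
theorem sum_improvement_le (hH : 2 ≤ H) (hw : ‖w‖ ≤ 1) (adv : Adversary d A H w) {T : ℕ}
    (hT : 2 ≤ T) {h : List (Round d H)}
    (hh : h ∈ (transcript (perceptron d hH) adv T).support) :
    (h.map fun r => (inner ℝ (r.feedback - r.offer.main) w : ℝ)).sum ≤
      14 * (d * Real.log T) := by
  have hlen := length_of_mem_support _ adv T hh
  have hmem : ∀ y ∈ h.map improvement, ∃ z : EuclideanSpace ℝ (Fin d),
      y = z.ofLp ∧ ‖z‖ ≤ 2 ∧ 0 ≤ (inner ℝ z w : ℝ) := by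
    intro y hy
    obtain ⟨r, hr, rfl⟩ := List.mem_map.1 hy
    obtain ⟨h', o, rfl⟩ := mem_of_mem_support _ adv T hh hr
    exact ⟨_, rfl, norm_feedback_sub_main_le adv h' o, inner_main_le_feedback adv h' o⟩
  have key := sum_dotProduct_le (l := h.map improvement) (u := w.ofLp)
    (opposing_of_mem_support hH adv T hh) ?_ ?_ ?_ ?_ (by rwa [List.length_map, hlen])
  · rw [dotProduct_list_sum, List.map_map, List.length_map, hlen, Fintype.card_fin] at key
    simp only [inner_eq_dotProduct]
    exact key
  · rw [← inner_eq_dotProduct, real_inner_self_eq_norm_sq]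
    nlinarith [norm_nonneg w]
  · intro y hy
    obtain ⟨z, rfl, -, hz⟩ := hmem y hy
    rwa [← inner_eq_dotProduct]
  · intro y hy
    obtain ⟨z, rfl, hz, -⟩ := hmem y hy
    rw [← inner_eq_dotProduct]
    nlinarith [real_inner_le_norm z w, norm_nonneg z, norm_nonneg w]
  · intro y hy
    obtain ⟨z, rfl, hz, -⟩ := hmem y hy
    rw [← inner_eq_dotProduct, real_inner_self_eq_norm_sq]
    nlinarith [norm_nonneg z]

/-- Scaled regret is excess plus improvement: the excess has nonpositive mean, and the improvement
is bounded on every path of the support. -/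
theorem expectedRegret_perceptron_le (hH : 2 ≤ H) (hHA : H ≤ A) (hw : ‖w‖ ≤ 1)
    (adv : Adversary d A H w) {T : ℕ} (hT : 2 ≤ T) :
    ((H : ℝ) - 1) / A * expectedRegret (perceptron d hH) adv T ≤ 14 * (d * Real.log T) := by
  have h1 := mean_sum_nonpos (perceptron d hH) adv (mean_excess_nonpos hH hHA adv) T
  have h2 := mean_le_mean_add_const (f := fun h => ((H : ℝ) - 1) / A * regret w h)
    (g := fun h => (h.map (excess A w)).sum) (b := 14 * (d * Real.log T))
    (transcript_support_finite (perceptron d hH) adv T) fun h hh => by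
      have := sum_improvement_le hH hw adv hT hh
      rw [sum_excess]
      linarith
  rw [mean_const_mul] at h2
  change _ * mean _ _ ≤ _
  linarith

end Learner

end LocalRec

theorem corollary6p3 :
    ∃ C : ℝ, ∀ d T A H : ℕ, 2 ≤ T → 2 ≤ H → H ≤ A →
      ∃ alg : LocalRec.Algorithm d H,
        ∀ w : EuclideanSpace ℝ (Fin d), ‖w‖ ≤ 1 →
          ∀ adv : LocalRec.Adversary d A H w,
            LocalRec.expectedRegret alg adv T ≤
              C * ((A : ℝ) / ((H : ℝ) - 1) * ((d : ℝ) * Real.log (T : ℝ))) := by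
  refine ⟨14, fun d T A H hT hH hHA => ⟨LocalRec.perceptron d hH, fun w hw adv => ?_⟩⟩
  have hH' : (2 : ℝ) ≤ H := by exact_mod_cast hH
  have hHA' : (H : ℝ) ≤ A := by exact_mod_cast hHA
  have hc : 0 < ((H : ℝ) - 1) / A := div_pos (by linarith) (by linarith)
  have h := LocalRec.expectedRegret_perceptron_le hH hHA hw adv hT
  rw [mul_comm, ← le_div_iff₀ hc] at h
  refine h.trans_eq ?_
  rw [div_div_eq_mul_div]
  ring
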